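/- Let $\mathbb K$ be $\mathbb R$ or $\mathbb C$ and let $n$ be a natural number. For a Banach space $E$ over $\mathbb K$ let $\mathcal P^n(E)$ be the space of continuous $n$-homogeneous polynomials $P:E\to\mathbb K$, i.e. $P(x)=A(x,\dots,x)$ for a (unique) continuous symmetric $n$-linear form $A$ on $E$. A Banach ideal of $n$-homogeneous polynomials is a pair $(\mathcal Q,\|\cdot\|_{\mathcal Q})$ assigning to each Banach space $E$ a linear subspace $\mathcal Q(E)\subseteq\mathcal P^n(E)$ with a norm $\|\cdot\|_{\mathcal Q(E)}$ that makes it a Banach space, such that (i) if $T:E_1\to E$ is a bounded operator and $P\in\mathcal Q(E)$, then $P\circ T\in\mathcal Q(E_1)$ and $\|P\circ T\|_{\mathcal Q(E_1)}\le\|P\|_{\mathcal Q(E)}\|T\|^n$; (ii) $z\mapsto z^n$ belongs to $\mathcal Q(\mathbb K)$ and has norm $1$ there. The minimal kernel $\mathcal Q^{\min}$ of $\mathcal Q$ consists of the polynomials $P:E\to\mathbb K$ that admit a factorization $P=R\circ T$ through a Banach space $F$, with $T:E\to F$ an approximable operator (an operator-norm limit of finite rank operators) and $R\in\mathcal Q(F)$;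 its norm is $\|P\|_{\mathcal Q^{\min}(E)}=\inf\|R\|_{\mathcal Q(F)}\|T\|^n$, the infimum being taken over all such factorizations. The ideal $\mathcal Q$ is called minimal if $\mathcal Q(E)=\mathcal Q^{\min}(E)$ with equal norms for every Banach space $E$. For an ultrafilter $\mathfrak U$ on a set $I$, the ultrapower $(E)_{\mathfrak U}$ is the Banach space of classes $(z_i)_{\mathfrak U}$ of bounded families $(z_i)_{i\in I}$ in $E$, two families $(z_i)$, $(y_i)$ being identified if $\lim_{i,\mathfrak U}\|z_i-y_i\|=0$, with the norm $\|(z_i)_{\mathfrak U}\|=\lim_{i,\mathfrak U}\|z_i\|$. The iterated extension of $P\in\mathcal P^n(E)$, with associated symmetric $n$-linear form $A$, is the function $\overline P:(E)_{\mathfrak U}\to\mathbb K$ given by $$\overline P\big((z_i)_{\mathfrak U}\big)=\lim_{i_1,\mathfrak U}\cdots\lim_{i_n,\mathfrak U}A(z_{i_1},\dots,z_{i_n}).$$ **Theorem.** Let $\mathcal Q$ be a minimal Banach ideal of $n$-homogeneous polynomials, let $E$ be a Banach space, let $\mathfrak U$ be an ultrafilter on a set $I$, and let $P\in\mathcal Q(E)$.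 Then the iterated extension $\overline P$ belongs to $\mathcal Q((E)_{\mathfrak U})$ and $$\|P\|_{\mathcal Q(E)}=\|\overline P\|_{\mathcal Q((E)_{\mathfrak U})}.$$ -/

import Mathlib

open Filter Topology
open scoped ENNReal

universe u v

noncomputable section

namespace PolyIdeals

/-! ### Continuous homogeneous polynomials -/

section Polynomials

variable (𝕜 : Type v) [RCLike 𝕜] (n : ℕ)
variable (E : Type u) [NormedAddCommGroup E] [NormedSpace 𝕜 E]

/-- The restriction of a continuous `n`-linear form to the diagonal, `x ↦ A (x, …, x)`. -/
def diagonal : ContinuousMultilinearMap 𝕜 (fun _ : Fin n => E) 𝕜 →ₗ[𝕜] (E → 𝕜) where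
  toFun A := fun x => A fun _ => x
  map_add' _ _ := rfl
  map_smul' _ _ := rfl

/-- The space of continuous scalar valued `n`-homogeneous polynomials on `E`. -/
def HomPoly : Submodule 𝕜 (E → 𝕜) := LinearMap.range (diagonal 𝕜 n E)

variable {𝕜 n E}

/-- An `n`-linear form is symmetric if it is invariant under permutations of its arguments. -/
def IsSymmForm (A : ContinuousMultilinearMap 𝕜 (fun _ : Fin n => E) 𝕜) : Prop :=
  ∀ (σ : Equiv.Perm (Fin n)) (x : Fin n → E), A (fun j => x (σ j)) = A x

/-- A continuous `n`-homogeneous polynomial is the diagonal of exactly one symmetric form. -/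
theorem existsUnique_symmForm {P : E → 𝕜} (hP : P ∈ HomPoly 𝕜 n E) :
    ∃! A : ContinuousMultilinearMap 𝕜 (fun _ : Fin n => E) 𝕜,
      IsSymmForm A ∧ ∀ x, A (fun _ => x) = P x := by
  obtain ⟨B, rfl⟩ := hP
  have hn : ((n.factorial : ℕ) : 𝕜) ≠ 0 := by exact_mod_cast n.factorial_ne_zero
  refine ⟨((n.factorial : ℕ) : 𝕜)⁻¹ • ∑ σ : Equiv.Perm (Fin n), B.domDomCongr σ, ⟨?_, ?_⟩, ?_⟩
  · intro τ x
    simp only [smul_apply, sum_apply,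
      ContinuousMultilinearMap.domDomCongr_apply]
    congr 1
    exact Fintype.sum_equiv (Equiv.mulLeft τ) _ _ fun σ => rfl
  · intro x
    simp [diagonal, Fintype.card_perm, hn]
  · rintro A ⟨hA, hAB⟩
    have key : ∀ C : ContinuousMultilinearMap 𝕜 (fun _ : Fin n => E) 𝕜, ∀ v : Fin n → E,
        iteratedFDeriv 𝕜 n (fun x => C fun _ => x) 0 v
          = ∑ σ : Equiv.Perm (Fin n), C (fun i => v (σ i)) := fun C v => by
      rw [C.iteratedFDeriv_comp_diagonal]
    ext v
    have h1 := key A v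
    have h2 := key B v
    have hfun : (fun x => A fun _ => x) = fun x => B fun _ => x := funext hAB
    rw [hfun, h2] at h1
    have h3 : ∑ σ : Equiv.Perm (Fin n), A (fun i => v (σ i)) = (n.factorial : 𝕜) * A v := by
      simp [hA _ v, Fintype.card_perm]
    rw [h3] at h1
    simp only [smul_apply, sum_apply,
      ContinuousMultilinearMap.domDomCongr_apply, smul_eq_mul, h1]
    field_simp

/-- The symmetric `n`-linear form associated with a continuous `n`-homogeneous polynomial. -/
def symmForm {P : E → 𝕜} (hP : P ∈ HomPoly 𝕜 n E) :
    ContinuousMultilinearMap 𝕜 (fun _ : Fin n => E) 𝕜 :=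
  (existsUnique_symmForm hP).choose

end Polynomials

/-! ### Approximable operators -/

/-- An operator is approximable if it is a limit, in operator norm, of finite rank operators. -/
def IsApproximable {𝕜 : Type v} [RCLike 𝕜] {E F : Type u}
    [NormedAddCommGroup E] [NormedSpace 𝕜 E] [NormedAddCommGroup F] [NormedSpace 𝕜 F]
    (T : E →L[𝕜] F) : Prop :=
  T ∈ closure {S : E →L[𝕜] F | FiniteDimensional 𝕜 (LinearMap.range (S : E →ₗ[𝕜] F))}

/-! ### Ultrapowers -/

section Ultrapowers

variable (𝕜 : Type v) [RCLike 𝕜] {I : Type u} (𝔘 : Ultrafilter I)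
variable (E : Type u) [NormedAddCommGroup E] [NormedSpace 𝕜 E]

/-- The bounded families `(z i)` in `E` with `lim_𝔘 ‖z i‖ = 0`. -/
def nullFamilies : Submodule 𝕜 (lp (fun _ : I => E) ∞) where
  carrier := {z | Tendsto (fun i => ‖z i‖) 𝔘 (𝓝 0)}
  zero_mem' := by simp
  add_mem' {z w} hz hw := by
    refine squeeze_zero (fun _ => norm_nonneg _) (fun i => ?_) (by simpa using hz.add hw)
    simpa using norm_add_le (z i) (w i)
  smul_mem' c z hz := by
    simpa [norm_smul] using hz.const_mul ‖c‖

instance isClosed_nullFamilies :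
    IsClosed (nullFamilies 𝕜 𝔘 E : Set (lp (fun _ : I => E) ∞)) := by
  refine isClosed_of_closure_subset fun z hz => ?_
  change Tendsto (fun i => ‖z i‖) 𝔘 (𝓝 0)
  rw [Metric.tendsto_nhds]
  intro ε hε
  obtain ⟨w, hw, hzw⟩ := Metric.mem_closure_iff.1 hz (ε / 2) (half_pos hε)
  filter_upwards [(Metric.tendsto_nhds.1 hw) (ε / 2) (half_pos hε)] with i hi
  have h1 : ‖z i - w i‖ ≤ ‖z - w‖ := lp.norm_apply_le_norm (by simp) (z - w) i
  have h2 : ‖z i‖ ≤ ‖z i - w i‖ + ‖w i‖ := by simpa using norm_add_le (z i - w i) (w i)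
  rw [dist_eq_norm] at hzw
  simp only [dist_zero_right, norm_norm] at hi ⊢
  linarith

/-- The ultrapower `(E)_𝔘`: bounded families in `E`, two families being identified if
`lim_𝔘 ‖z i - y i‖ = 0`. Its norm is the quotient norm, which is `lim_𝔘 ‖z i‖` by
`tendsto_norm_mk` below. -/
abbrev Ultrapower : Type u := lp (fun _ : I => E) ∞ ⧸ nullFamilies 𝕜 𝔘 E

variable {𝕜 E}

/-- The norm of the class of a family `z` is `lim_𝔘 ‖z i‖`. -/
theorem tendsto_norm_mk (z : lp (fun _ : I => E) ∞) :
    Tendsto (fun i => ‖z i‖) 𝔘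
      (𝓝 ‖(Submodule.Quotient.mk z : Ultrapower 𝕜 𝔘 E)‖) := by
  have hbd : ∀ i, ‖z i‖ ≤ ‖z‖ := fun i => lp.norm_apply_le_norm (by simp) z i
  obtain ⟨L, hLmem, hL⟩ := (isCompact_Icc (a := (0 : ℝ)) (b := ‖z‖)).ultrafilter_le_nhds
    (𝔘.map fun i => ‖z i‖) (by
      rw [Ultrafilter.coe_map, le_principal_iff]
      exact mem_map.2 (univ_mem' fun i => ⟨norm_nonneg (z i), hbd i⟩))
  have hT : Tendsto (fun i => ‖z i‖) 𝔘 (𝓝 L) := hL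
  suffices h : ‖(Submodule.Quotient.mk z : Ultrapower 𝕜 𝔘 E)‖ = L by rwa [h]
  apply le_antisymm
  · refine le_of_forall_pos_le_add fun ε hε => ?_
    classical
    let w : lp (fun _ : I => E) ∞ :=
      ⟨fun i => if ‖z i‖ ≤ L + ε then z i else 0, memℓp_infty ⟨‖z‖, by
        rintro _ ⟨i, rfl⟩
        dsimp only
        split_ifs
        · exact hbd i
        · simp⟩⟩
    have hw : ∀ i, w i = if ‖z i‖ ≤ L + ε then z i else 0 := fun _ => rfl
    have hzw : (Submodule.Quotient.mk z : Ultrapower 𝕜 𝔘 E) = Submodule.Quotient.mk w := by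
      rw [Submodule.Quotient.eq]
      refine tendsto_const_nhds.congr' ?_
      filter_upwards [hT.eventually (ge_mem_nhds (lt_add_of_pos_right L hε))] with i hi
      simp [hw, hi]
    rw [hzw]
    refine (Submodule.Quotient.norm_mk_le _ w).trans
      (lp.norm_le_of_forall_le (by linarith [hLmem.1]) fun i => ?_)
    rw [hw]
    split_ifs with h
    · exact h
    · simpa using by linarith [hLmem.1]
  · refine le_of_forall_pos_le_add fun ε hε => ?_
    obtain ⟨w, hw, hlt⟩ := Submodule.Quotient.norm_mk_lt
      (Submodule.Quotient.mk z : Ultrapower 𝕜 𝔘 E) hε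
    have hzw : Tendsto (fun i => ‖(z - w) i‖) 𝔘 (𝓝 0) :=
      (Submodule.Quotient.eq (nullFamilies 𝕜 𝔘 E)).1 hw.symm
    refine le_trans ?_ hlt.le
    have h0 : Tendsto (fun i => ‖z i‖ - ‖(z - w) i‖) 𝔘 (𝓝 (L - 0)) := hT.sub hzw
    rw [sub_zero] at h0
    refine le_of_tendsto h0 (Eventually.of_forall fun i => ?_)
    have h1 : ‖w i‖ ≤ ‖w‖ := lp.norm_apply_le_norm (by simp) w i
    have h2 : ‖z i‖ ≤ ‖(z - w) i‖ + ‖w i‖ := by simpa using norm_add_le (z i - w i) (w i)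
    linarith

/-- The iterated limit `lim_{i₁,𝔘} ⋯ lim_{iₙ,𝔘} f (i₁, …, iₙ)`; the limit over the first index is
the outermost one. -/
def iteratedLim : (n : ℕ) → ((Fin n → I) → 𝕜) → 𝕜
  | 0, f => f Fin.elim0
  | n + 1, f => limUnder (𝔘 : Filter I) fun i => iteratedLim n fun s => f (Fin.cons i s)

/-- Bounded scalar families converge along an ultrafilter. -/
theorem tendsto_limUnder_of_bounded {g : I → 𝕜} {C : ℝ} (hg : ∀ i, ‖g i‖ ≤ C) :
    Tendsto g 𝔘 (𝓝 (limUnder (𝔘 : Filter I) g)) := by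
  obtain ⟨a, -, ha⟩ := (isCompact_closedBall (0 : 𝕜) C).ultrafilter_le_nhds (𝔘.map g) (by
    rw [Ultrafilter.coe_map, le_principal_iff]
    exact mem_map.2 (univ_mem' fun i => by simpa using hg i))
  exact tendsto_nhds_limUnder ⟨a, ha⟩

theorem norm_iteratedLim_le {C : ℝ} : ∀ {n : ℕ} {f : (Fin n → I) → 𝕜}, (∀ s, ‖f s‖ ≤ C) →
    ‖iteratedLim 𝔘 n f‖ ≤ C
  | 0, _, hf => hf _
  | n + 1, f, hf => by
    have h : ∀ i, ‖iteratedLim 𝔘 n fun s => f (Fin.cons i s)‖ ≤ C := fun i =>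
      norm_iteratedLim_le fun s => hf _
    exact le_of_tendsto (tendsto_limUnder_of_bounded 𝔘 h).norm (Eventually.of_forall h)

theorem iteratedLim_sub {C D : ℝ} : ∀ {n : ℕ} {f g : (Fin n → I) → 𝕜}, (∀ s, ‖f s‖ ≤ C) →
    (∀ s, ‖g s‖ ≤ D) →
    iteratedLim 𝔘 n (fun s => f s - g s) = iteratedLim 𝔘 n f - iteratedLim 𝔘 n g
  | 0, _, _, _, _ => rfl
  | n + 1, f, g, hf, hg => by
    have h1 := tendsto_limUnder_of_bounded 𝔘 fun i =>
      norm_iteratedLim_le (f := fun s => f (Fin.cons i s)) 𝔘 fun s => hf _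
    have h2 := tendsto_limUnder_of_bounded 𝔘 fun i =>
      norm_iteratedLim_le (f := fun s => g (Fin.cons i s)) 𝔘 fun s => hg _
    refine Tendsto.limUnder_eq ((h1.sub h2).congr fun i => ?_)
    exact (iteratedLim_sub (fun s => hf _) fun s => hg _).symm

/-- The iterated limit of `Φ` along bounded families depends only on their classes. -/
theorem iteratedLim_congr : ∀ {n : ℕ} (Φ : ContinuousMultilinearMap 𝕜 (fun _ : Fin n => E) 𝕜)
    (z w : Fin n → lp (fun _ : I => E) ∞), (∀ j, z j - w j ∈ nullFamilies 𝕜 𝔘 E) →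
    iteratedLim 𝔘 n (fun s => Φ fun j => z j (s j)) =
      iteratedLim 𝔘 n (fun s => Φ fun j => w j (s j))
  | 0, Φ, z, w, _ => congrArg Φ (Subsingleton.elim _ _)
  | n + 1, Φ, z, w, h => by
    have hcons : ∀ (y : Fin (n + 1) → lp (fun _ : I => E) ∞) (i : I) (s : Fin n → I),
        (Φ fun j => y j ((Fin.cons i s : Fin (n + 1) → I) j)) =
          Φ.curryLeft (y 0 i) fun j => y j.succ (s j) := fun y i s => by
      rw [ContinuousMultilinearMap.curryLeft_apply]
      congr 1
      funext j
      refine Fin.cases ?_ (fun j => ?_) j <;> simp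
    have hbd : ∀ (x : E) (s : Fin n → I),
        ‖Φ.curryLeft x fun j => w j.succ (s j)‖ ≤ ‖Φ.curryLeft‖ * ‖x‖ * ∏ j : Fin n, ‖w j.succ‖ :=
      fun x s => by
        refine (ContinuousMultilinearMap.le_opNorm _ _).trans ?_
        gcongr
        · exact Φ.curryLeft.le_opNorm x
        · exact lp.norm_apply_le_norm (by simp) _ _
    let G : E → 𝕜 := fun x => iteratedLim 𝔘 n fun s => Φ.curryLeft x fun j => w j.succ (s j)
    have hG : ∀ x y : E, ‖G x - G y‖ ≤ ‖Φ.curryLeft‖ * ‖x - y‖ * ∏ j : Fin n, ‖w j.succ‖ := by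
      intro x y
      rw [← iteratedLim_sub 𝔘 (hbd x) (hbd y)]
      refine norm_iteratedLim_le 𝔘 fun s => ?_
      rw [← sub_apply, ← map_sub]
      exact hbd _ s
    have hw : Tendsto (fun i => G (w 0 i)) 𝔘 (𝓝 (limUnder (𝔘 : Filter I) fun i => G (w 0 i))) := by
      refine tendsto_limUnder_of_bounded (C := ‖Φ.curryLeft‖ * ‖w 0‖ * ∏ j : Fin n, ‖w j.succ‖) 𝔘
        fun i => norm_iteratedLim_le 𝔘 fun s => (hbd _ s).trans ?_
      gcongr
      exact lp.norm_apply_le_norm (by simp) _ _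
    have h0 : Tendsto (fun i => G (z 0 i) - G (w 0 i)) 𝔘 (𝓝 0) := by
      have h1 : Tendsto (fun i => ‖z 0 i - w 0 i‖) 𝔘 (𝓝 0) := h 0
      refine squeeze_zero_norm (fun i => hG _ _) ?_
      simpa using (h1.const_mul ‖Φ.curryLeft‖).mul_const (∏ j : Fin n, ‖w j.succ‖)
    have hz : limUnder (𝔘 : Filter I) (fun i => G (z 0 i)) =
        limUnder (𝔘 : Filter I) fun i => G (w 0 i) :=
      Tendsto.limUnder_eq (by simpa using h0.add hw)
    calc iteratedLim 𝔘 (n + 1) (fun s => Φ fun j => z j (s j))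
        = limUnder (𝔘 : Filter I) fun i => G (z 0 i) := by
          refine congrArg (limUnder (𝔘 : Filter I)) (funext fun i => ?_)
          simp only [hcons z]
          exact iteratedLim_congr (Φ.curryLeft (z 0 i)) (fun j => z j.succ) (fun j => w j.succ)
            fun j => h j.succ
      _ = limUnder (𝔘 : Filter I) fun i => G (w 0 i) := hz
      _ = iteratedLim 𝔘 (n + 1) (fun s => Φ fun j => w j (s j)) := by
          refine congrArg (limUnder (𝔘 : Filter I)) (funext fun i => ?_)
          simp only [hcons w, G]

/-- The iterated extension of a continuous `n`-linear form to the ultrapower,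
`(z₁, …, zₙ) ↦ lim_{i₁,𝔘} ⋯ lim_{iₙ,𝔘} Φ (z₁ i₁, …, zₙ iₙ)`, the `zⱼ` being represented by
bounded families; the choice of these families is immaterial by `extendForm_mk` below. -/
def extendForm {n : ℕ} (Φ : ContinuousMultilinearMap 𝕜 (fun _ : Fin n => E) 𝕜)
    (z : Fin n → Ultrapower 𝕜 𝔘 E) : 𝕜 :=
  iteratedLim 𝔘 n fun s => Φ fun j => (Quotient.out (z j) : lp (fun _ : I => E) ∞) (s j)

/-- The iterated extension may be computed with any representing families. -/
theorem extendForm_mk {n : ℕ} (Φ : ContinuousMultilinearMap 𝕜 (fun _ : Fin n => E) 𝕜)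
    (w : Fin n → lp (fun _ : I => E) ∞) :
    extendForm 𝔘 Φ (fun j => (Submodule.Quotient.mk (w j) : Ultrapower 𝕜 𝔘 E)) =
      iteratedLim 𝔘 n fun s => Φ fun j => w j (s j) :=
  iteratedLim_congr 𝔘 Φ _ w fun _ =>
    (Submodule.Quotient.eq (nullFamilies 𝕜 𝔘 E)).1 (Quotient.out_eq _)

/-- The iterated extension of a continuous `n`-homogeneous polynomial to the ultrapower. -/
def iteratedExtension {n : ℕ} {P : E → 𝕜} (hP : P ∈ HomPoly 𝕜 n E) : Ultrapower 𝕜 𝔘 E → 𝕜 :=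
  fun z => extendForm 𝔘 (symmForm hP) fun _ => z

end Ultrapowers

/-! ### Banach ideals of homogeneous polynomials -/

/-- A Banach ideal of continuous scalar valued `n`-homogeneous polynomials, on the Banach spaces
over `𝕜` in the universe `u`. The values of `norm` matter only on the members of the ideal. -/
structure BanachPolyIdeal (𝕜 : Type) [RCLike 𝕜] (n : ℕ) where
  /-- The component of the ideal on a Banach space `E`. -/
  space : ∀ (E : Type u) [NormedAddCommGroup E] [NormedSpace 𝕜 E] [CompleteSpace E],
    Submodule 𝕜 (E → 𝕜)
  /-- The ideal norm on the component on `E`. -/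
  norm : ∀ (E : Type u) [NormedAddCommGroup E] [NormedSpace 𝕜 E] [CompleteSpace E],
    (E → 𝕜) → ℝ
  space_le : ∀ (E : Type u) [NormedAddCommGroup E] [NormedSpace 𝕜 E] [CompleteSpace E],
    space E ≤ HomPoly 𝕜 n E
  norm_add_le : ∀ (E : Type u) [NormedAddCommGroup E] [NormedSpace 𝕜 E] [CompleteSpace E],
    ∀ P ∈ space E, ∀ R ∈ space E, norm E (P + R) ≤ norm E P + norm E R
  norm_smul : ∀ (E : Type u) [NormedAddCommGroup E] [NormedSpace 𝕜 E] [CompleteSpace E],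
    ∀ (c : 𝕜), ∀ P ∈ space E, norm E (c • P) = ‖c‖ * norm E P
  eq_zero_of_norm_eq_zero :
    ∀ (E : Type u) [NormedAddCommGroup E] [NormedSpace 𝕜 E] [CompleteSpace E],
    ∀ P ∈ space E, norm E P = 0 → P = 0
  /-- Every Cauchy sequence of `space E` converges in `space E`. -/
  complete : ∀ (E : Type u) [NormedAddCommGroup E] [NormedSpace 𝕜 E] [CompleteSpace E],
    ∀ p : ℕ → E → 𝕜, (∀ k, p k ∈ space E) →
      (∀ ε > 0, ∃ N, ∀ k ≥ N, ∀ l ≥ N, norm E (p k - p l) < ε) →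
      ∃ P ∈ space E, Tendsto (fun k => norm E (p k - P)) atTop (𝓝 0)
  comp_mem : ∀ (E₁ E : Type u) [NormedAddCommGroup E₁] [NormedSpace 𝕜 E₁] [CompleteSpace E₁]
    [NormedAddCommGroup E] [NormedSpace 𝕜 E] [CompleteSpace E],
    ∀ (T : E₁ →L[𝕜] E), ∀ P ∈ space E, P ∘ T ∈ space E₁
  norm_comp_le : ∀ (E₁ E : Type u) [NormedAddCommGroup E₁] [NormedSpace 𝕜 E₁] [CompleteSpace E₁]
    [NormedAddCommGroup E] [NormedSpace 𝕜 E] [CompleteSpace E],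
    ∀ (T : E₁ →L[𝕜] E), ∀ P ∈ space E, norm E₁ (P ∘ T) ≤ norm E P * ‖T‖ ^ n
  /-- `z ↦ z ^ n` on the scalar field (lifted to the universe `u`) belongs to the ideal. -/
  pow_mem : (fun z : ULift.{u} 𝕜 => z.down ^ n) ∈ space (ULift.{u} 𝕜)
  norm_pow : norm (ULift.{u} 𝕜) (fun z => z.down ^ n) = 1

namespace BanachPolyIdeal

variable {𝕜 : Type} [RCLike 𝕜] {n : ℕ} (Q : BanachPolyIdeal.{u} 𝕜 n)
variable (E : Type u) [NormedAddCommGroup E] [NormedSpace 𝕜 E] [CompleteSpace E]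

/-- The numbers `‖R‖_{Q(F)} * ‖T‖ ^ n`, over all factorizations `P = R ∘ T` of `P` through a Banach
space `F` with `T : E → F` approximable and `R ∈ Q(F)`. -/
def minValues (P : E → 𝕜) : Set ℝ :=
  {r | ∃ (F : Type u) (_ : NormedAddCommGroup F) (_ : NormedSpace 𝕜 F) (_ : CompleteSpace F)
    (T : E →L[𝕜] F) (R : F → 𝕜), IsApproximable T ∧ R ∈ Q.space F ∧ P = R ∘ T ∧
      r = Q.norm F R * ‖T‖ ^ n}

/-- Membership in the component on `E` of the minimal kernel of `Q`: there is a factorization. -/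
def MemMin (P : E → 𝕜) : Prop := (Q.minValues E P).Nonempty

/-- The norm of the minimal kernel of `Q`. -/
def minNorm (P : E → 𝕜) : ℝ := sInf (Q.minValues E P)

/-- `Q` is minimal if it coincides with its minimal kernel, with equal norms. -/
def IsMinimal : Prop :=
  ∀ (E : Type u) [NormedAddCommGroup E] [NormedSpace 𝕜 E] [CompleteSpace E],
    (∀ P : E → 𝕜, P ∈ Q.space E ↔ Q.MemMin E P) ∧
    ∀ P ∈ Q.space E, Q.norm E P = Q.minNorm E P

end BanachPolyIdeal

end PolyIdeals

end

/-! By minimality `P` factors as `R ∘ T` with `T : E → F` approximable, hence compact. For a bounded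
family `(z i)` the points `T (z i)` lie in a compact set, so they converge in norm along `𝔘`. Their
limit depends only on the class of the family and defines an operator `S` on the ultrapower with
`‖S‖ ≤ ‖T‖` (`exists_ultrapower_extension`). Norm convergence lets the iterated limits pass inside
the continuous symmetric form of `R`, so the iterated extension of `P` is `R ∘ S`
(`iteratedExtension_eq_comp`). The ideal property applied to `R` and `S` gives membership and the
bound `‖R‖ * ‖T‖ ^ n`; the infimum over all factorizations is `‖P‖`, again by minimality.

Conversely, `P` is its extension composed with the contraction `J` that embeds `E` as constant
families, so the ideal property bounds `‖P‖` by the norm of the extension. -/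

namespace PolyIdeals

section IteratedLimits

variable {𝕜 : Type v} [RCLike 𝕜] {I : Type u} (𝔘 : Ultrafilter I)
variable {F : Type u} [NormedAddCommGroup F] [NormedSpace 𝕜 F]

/-- Along convergent families, the iterated limit of a continuous multilinear form is its value at
the limits. -/
theorem iteratedLim_eq_of_tendsto : ∀ {n : ℕ}
    (Φ : ContinuousMultilinearMap 𝕜 (fun _ : Fin n => F) 𝕜) (w : Fin n → I → F) (l : Fin n → F),
    (∀ j, Tendsto (w j) 𝔘 (𝓝 (l j))) →
    iteratedLim 𝔘 n (fun s => Φ fun j => w j (s j)) = Φ l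
  | 0, Φ, w, l, _ => congrArg Φ (Subsingleton.elim _ _)
  | n + 1, Φ, w, l, h => by
    have hcons : ∀ (i : I) (s : Fin n → I),
        (Φ fun j => w j ((Fin.cons i s : Fin (n + 1) → I) j)) =
          Φ.curryLeft (w 0 i) fun j => w j.succ (s j) := fun i s => by
      rw [ContinuousMultilinearMap.curryLeft_apply]
      congr 1
      funext j
      refine Fin.cases ?_ (fun j => ?_) j <;> simp
    -- By induction on the curried form, the `n` inner limits evaluate to the limit points, leaving
    -- a continuous function of `w 0 i` alone.
    have hlim : ∀ i, iteratedLim 𝔘 n (fun s => Φ fun j => w j ((Fin.cons i s : Fin (n + 1) → I) j))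
        = Φ.curryLeft (w 0 i) fun j => l j.succ := fun i => by
      simp only [hcons]
      exact iteratedLim_eq_of_tendsto _ (fun j => w j.succ) _ fun j => h j.succ
    have hl : Φ l = Φ.curryLeft (l 0) fun j => l j.succ := by
      rw [ContinuousMultilinearMap.curryLeft_apply]
      exact congrArg Φ (Fin.cons_self_tail l).symm
    have hcont : Continuous fun x => Φ.curryLeft x fun j => l j.succ :=
      (continuous_eval_const _).comp Φ.curryLeft.continuous
    rw [hl]
    refine Tendsto.limUnder_eq ?_
    simp only [hlim]
    exact (hcont.tendsto (l 0)).comp (h 0)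

end IteratedLimits

section SymmForm

variable {𝕜 : Type v} [RCLike 𝕜] {n : ℕ}
variable {E F : Type u} [NormedAddCommGroup E] [NormedSpace 𝕜 E]
  [NormedAddCommGroup F] [NormedSpace 𝕜 F]

theorem isSymmForm_symmForm {P : E → 𝕜} (hP : P ∈ HomPoly 𝕜 n E) : IsSymmForm (symmForm hP) :=
  (existsUnique_symmForm hP).choose_spec.1.1

theorem symmForm_apply_diagonal {P : E → 𝕜} (hP : P ∈ HomPoly 𝕜 n E) (x : E) :
    symmForm hP (fun _ => x) = P x :=
  (existsUnique_symmForm hP).choose_spec.1.2 x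

/-- The symmetric form of `R ∘ T` is the symmetric form of `R`, composed with `T`. -/
theorem symmForm_comp {R : F → 𝕜} (hR : R ∈ HomPoly 𝕜 n F) (T : E →L[𝕜] F)
    (hRT : R ∘ T ∈ HomPoly 𝕜 n E) :
    symmForm hRT = (symmForm hR).compContinuousLinearMap fun _ => T := by
  refine (existsUnique_symmForm hRT).unique
    ⟨isSymmForm_symmForm hRT, symmForm_apply_diagonal hRT⟩ ⟨fun σ x => ?_, fun x => ?_⟩
  · exact isSymmForm_symmForm hR σ fun j => T (x j)
  · exact symmForm_apply_diagonal hR (T x)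

end SymmForm

section Ultrapowers

variable {𝕜 : Type v} [RCLike 𝕜] {I : Type u} (𝔘 : Ultrafilter I)
variable {E F : Type u} [NormedAddCommGroup E] [NormedSpace 𝕜 E]
  [NormedAddCommGroup F] [NormedSpace 𝕜 F]

/-- Compact operators into a complete space form a norm-closed set, so finite rank operators
suffice. -/
theorem IsApproximable.isCompactOperator [CompleteSpace F] {T : E →L[𝕜] F}
    (hT : IsApproximable T) : IsCompactOperator T := by
  refine closure_minimal (fun S hS => ?_) isClosed_setOfPred_isCompactOperator hT
  have : FiniteDimensional 𝕜 (LinearMap.range (S : E →ₗ[𝕜] F)) := hS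
  have : ProperSpace (LinearMap.range (S : E →ₗ[𝕜] F)) := FiniteDimensional.proper 𝕜 _
  -- Corestricted to its finite-dimensional range, `S` lands in a space whose closed balls are
  -- compact.
  let S' : E →L[𝕜] LinearMap.range (S : E →ₗ[𝕜] F) :=
    S.codRestrict _ fun x => LinearMap.mem_range_self (S : E →ₗ[𝕜] F) x
  have h' : IsCompactOperator S' :=
    ⟨Metric.closedBall 0 1, isCompact_closedBall 0 1,
      S'.continuous.continuousAt (by simpa using Metric.closedBall_mem_nhds _ one_pos)⟩
  exact h'.clm_comp (Submodule.subtypeL _)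

/-- A compact operator maps bounded families to families converging along an ultrafilter. -/
theorem exists_tendsto_of_isCompactOperator {T : E →L[𝕜] F} (hT : IsCompactOperator T)
    (z : lp (fun _ : I => E) ∞) : ∃ y, Tendsto (fun i => T (z i)) 𝔘 (𝓝 y) := by
  have hK := hT.isCompact_closure_image_closedBall (𝕜₁ := 𝕜) ‖z‖
  obtain ⟨y, -, hy⟩ := hK.ultrafilter_le_nhds (𝔘.map fun i => T (z i)) (by
    rw [Ultrafilter.coe_map, le_principal_iff]
    refine mem_map.2 (univ_mem' fun i => subset_closure ⟨z i, ?_, rfl⟩)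
    simpa using lp.norm_apply_le_norm (by simp) z i)
  exact ⟨y, hy⟩

/-- A compact operator `T : E → F` extends to the ultrapower of `E` by
`(z i) ↦ lim_𝔘 T (z i)`, without increasing its norm. -/
theorem exists_ultrapower_extension {T : E →L[𝕜] F} (hT : IsCompactOperator T) :
    ∃ S : Ultrapower 𝕜 𝔘 E →L[𝕜] F, ‖S‖ ≤ ‖T‖ ∧ ∀ z : lp (fun _ : I => E) ∞,
      Tendsto (fun i => T (z i)) 𝔘 (𝓝 (S (Submodule.Quotient.mk z))) := by
  choose L hL using exists_tendsto_of_isCompactOperator 𝔘 hT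
  let L' : lp (fun _ : I => E) ∞ →ₗ[𝕜] F :=
    { toFun := L
      map_add' := fun z w => tendsto_nhds_unique (hL (z + w)) (by
        simpa using (hL z).add (hL w))
      map_smul' := fun c z => tendsto_nhds_unique (hL (c • z)) (by
        simpa using (hL z).const_smul c) }
  -- Continuity of `T` at `0` sends null families to limit `0`, so the limit map descends to the
  -- quotient.
  have hker : nullFamilies 𝕜 𝔘 E ≤ LinearMap.ker L' := fun z hz => by
    refine tendsto_nhds_unique (hL z) ?_
    have hz' : Tendsto (fun i => z i) 𝔘 (𝓝 0) := tendsto_zero_iff_norm_tendsto_zero.2 hz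
    simpa [Function.comp_def] using (T.continuous.tendsto 0).comp hz'
  refine ⟨((nullFamilies 𝕜 𝔘 E).liftQ L' hker).mkContinuous ‖T‖ fun x => ?_,
    LinearMap.mkContinuous_norm_le _ (norm_nonneg _) _, hL⟩
  obtain ⟨z, rfl⟩ := Submodule.Quotient.mk_surjective _ x
  -- The bound `‖T (z i)‖ ≤ ‖T‖ * ‖z i‖` passes to the limit because the quotient norm is `lim_𝔘 ‖z
  -- i‖`.
  exact le_of_tendsto_of_tendsto (hL z).norm ((tendsto_norm_mk 𝔘 z).const_mul ‖T‖)
    (Eventually.of_forall fun i => T.le_opNorm (z i))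

/-- The canonical embedding of `E` into its ultrapower, as constant families, is a contraction. -/
theorem exists_ultrapower_embedding : ∃ J : E →L[𝕜] Ultrapower 𝕜 𝔘 E, ‖J‖ ≤ 1 ∧
    ∀ x, ∃ z : lp (fun _ : I => E) ∞, (∀ i, z i = x) ∧ J x = Submodule.Quotient.mk z := by
  let c : E →ₗ[𝕜] lp (fun _ : I => E) ∞ :=
    { toFun := fun x => ⟨fun _ => x, memℓp_infty ⟨‖x‖, by rintro _ ⟨i, rfl⟩; exact le_rfl⟩⟩
      map_add' := fun _ _ => rfl
      map_smul' := fun _ _ => rfl }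
  refine ⟨((nullFamilies 𝕜 𝔘 E).mkQ.comp c).mkContinuous 1 fun x => ?_,
    LinearMap.mkContinuous_norm_le _ zero_le_one _, fun x => ⟨c x, fun _ => rfl, rfl⟩⟩
  rw [one_mul]
  exact (tendsto_nhds_unique (tendsto_norm_mk (𝕜 := 𝕜) 𝔘 (c x)) tendsto_const_nhds).le

/-- If `S` extends `T` to the ultrapower, then `R ∘ S` is the iterated extension of `R ∘ T`. -/
theorem iteratedExtension_eq_comp {n : ℕ} {P : E → 𝕜} (hP : P ∈ HomPoly 𝕜 n E) {R : F → 𝕜}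
    (hR : R ∈ HomPoly 𝕜 n F) {T : E →L[𝕜] F} (hPR : P = R ∘ T) {S : Ultrapower 𝕜 𝔘 E →L[𝕜] F}
    (hS : ∀ z : lp (fun _ : I => E) ∞,
      Tendsto (fun i => T (z i)) 𝔘 (𝓝 (S (Submodule.Quotient.mk z)))) :
    iteratedExtension 𝔘 hP = R ∘ S := by
  subst hPR
  funext x
  obtain ⟨z, rfl⟩ := Submodule.Quotient.mk_surjective _ x
  rw [iteratedExtension, extendForm_mk 𝔘 (symmForm hP) fun _ => z, symmForm_comp hR T hP]
  exact (iteratedLim_eq_of_tendsto 𝔘 (symmForm hR) (fun _ i => T (z i)) _ fun _ => hS z).trans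
    (symmForm_apply_diagonal hR _)

end Ultrapowers

/-- Not an axiom of the structure: the triangle inequality and homogeneity give `0 = ‖P - P‖ ≤ 2 *
‖P‖`. -/
theorem BanachPolyIdeal.norm_nonneg {𝕜 : Type} [RCLike 𝕜] {n : ℕ} (Q : BanachPolyIdeal.{u} 𝕜 n)
    (E : Type u) [NormedAddCommGroup E] [NormedSpace 𝕜 E] [CompleteSpace E]
    {P : E → 𝕜} (hP : P ∈ Q.space E) : 0 ≤ Q.norm E P := by
  have h1 := Q.norm_add_le E P hP ((-1 : 𝕜) • P) ((Q.space E).smul_mem _ hP)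
  have h2 := Q.norm_smul E (-1) P hP
  have h3 := Q.norm_smul E 0 P hP
  have h4 : P + (-1 : 𝕜) • P = (0 : 𝕜) • P := by simp
  rw [h4, h3, h2] at h1
  simp only [norm_zero, zero_mul, norm_neg, norm_one, one_mul] at h1
  linarith

end PolyIdeals

open PolyIdeals in
theorem theorem3p7 {𝕜 : Type} [RCLike 𝕜] {n : ℕ} (Q : PolyIdeals.BanachPolyIdeal.{u} 𝕜 n)
    (hQ : Q.IsMinimal)
    {E : Type u} [NormedAddCommGroup E] [NormedSpace 𝕜 E] [CompleteSpace E]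
    {I : Type u} (𝔘 : Ultrafilter I) {P : E → 𝕜} (hP : P ∈ Q.space E) :
    PolyIdeals.iteratedExtension 𝔘 (Q.space_le E hP) ∈ Q.space (PolyIdeals.Ultrapower 𝕜 𝔘 E) ∧
      Q.norm E P = Q.norm (PolyIdeals.Ultrapower 𝕜 𝔘 E)
        (PolyIdeals.iteratedExtension 𝔘 (Q.space_le E hP)) := by
  have hne : (Q.minValues E P).Nonempty := ((hQ E).1 P).1 hP
  -- Only the bound by `r` depends on the factorization; membership and agreement with `P` on
  -- constant families follow from any single one.
  have key : ∀ r ∈ Q.minValues E P,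
      iteratedExtension 𝔘 (Q.space_le E hP) ∈ Q.space (Ultrapower 𝕜 𝔘 E) ∧
      Q.norm (Ultrapower 𝕜 𝔘 E) (iteratedExtension 𝔘 (Q.space_le E hP)) ≤ r ∧
      ∀ z : lp (fun _ : I => E) ∞, ∀ x, (∀ i, z i = x) →
        iteratedExtension 𝔘 (Q.space_le E hP) (Submodule.Quotient.mk z) = P x := by
    rintro r ⟨F, _, _, _, T, R, hT, hR, hPR, rfl⟩
    obtain ⟨S, hST, hS⟩ := exists_ultrapower_extension 𝔘 hT.isCompactOperator
    rw [iteratedExtension_eq_comp 𝔘 (Q.space_le E hP) (Q.space_le F hR) hPR hS]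
    refine ⟨Q.comp_mem _ _ S R hR, (Q.norm_comp_le _ _ S R hR).trans ?_, fun z x hz => ?_⟩
    · gcongr
      exact Q.norm_nonneg F hR
    · have h := hS z
      simp only [hz] at h
      rw [hPR, Function.comp_apply, Function.comp_apply,
        tendsto_nhds_unique h tendsto_const_nhds]
  obtain ⟨hmem, -, hres⟩ := key _ hne.some_mem
  refine ⟨hmem, le_antisymm ?_ ?_⟩
  · obtain ⟨J, hJ, hJz⟩ := exists_ultrapower_embedding (𝕜 := 𝕜) (E := E) 𝔘
    have hPJ : P = iteratedExtension 𝔘 (Q.space_le E hP) ∘ J := by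
      funext x
      obtain ⟨z, hz, hx⟩ := hJz x
      rw [Function.comp_apply, hx, hres z x hz]
    calc Q.norm E P = Q.norm E (iteratedExtension 𝔘 (Q.space_le E hP) ∘ J) :=
          congrArg (Q.norm E) hPJ
      _ ≤ _ := Q.norm_comp_le _ _ J _ hmem
      _ ≤ _ := mul_le_of_le_one_right (Q.norm_nonneg _ hmem) (pow_le_one₀ (norm_nonneg _) hJ)
  -- Minimality turns `‖P‖` into the infimum of the values `r`, each of which bounds the norm of the
  -- extension.
  · rw [(hQ E).2 P hP]
    exact le_csInf hne fun r hr => (key r hr).2.1
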